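/- **Setting.** There are $N$ items with features $x_1,\dots,x_N\in\mathbb R^d$, partitioned into $K$ baskets $B_1,\dots,B_K$; let $M=\max_k|B_k|$. Let $\mathbb S$ be a collection of non-empty assortments $s\subseteq[N]$ and let $r(s,a)\ge 0$ ($s\in\mathbb S$, $a\in s$) be known revenues. The nested logit model with parameter $\vartheta=(\theta;\lambda_1,\dots,\lambda_K)$, $\theta\in\mathbb R^d$, $0<\lambda_k\le 1$, is $$p(a\mid s;\vartheta)=\frac{v_j^{\lambda_j-1}}{1+\sum_k v_k^{\lambda_k}}\,e^{x_a^{\top}\theta/\lambda_j}\quad(a\in s\cap B_j),\qquad p(0\mid s;\vartheta)=\frac1{1+\sum_k v_k^{\lambda_k}},\qquad v_k=\sum_{i\in s\cap B_k}e^{x_i^{\top}\theta/\lambda_k},$$ where $a=0$ means no purchase. Let $\mathcal P=\{p(\cdot\mid\cdot;\vartheta):\vartheta\in\Theta\}$, where $\|x_j\|_2\le C_x$ for all $j$, and $\|\theta\|_2\le C_\Theta$, $1/\lambda_k\le C_\lambda$ for all $(\theta;\lambda)\in\Theta$ and all $k$. Put $D=d+K$ and $C=C_xC_\Theta C_\lambda$.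 The data $(S_i,A_i)_{i\le n}$ are i.i.d. with probability mass function $\pi_S(s)p_0(a\mid s)$, with $\pi_S$ a probability mass function on $\mathbb S$ and $p_0\in\mathcal P$. Let $\mathcal V(s;p)=\sum_{a\in s}p(a\mid s)r(s,a)$, let $s^\star$ maximize $\mathcal V(\cdot\,;p_0)$ over $\mathbb S$, and assume $\pi_S(s^\star)>0$. Let $\mathcal R(s)=\mathcal V(s^\star;p_0)-\mathcal V(s;p_0)$, $r_{s^\star}=\max_{a\in s^\star}r(s^\star,a)$ and $\widehat L_n(p)=-\frac1n\sum_i\log p(A_i\mid S_i)$. PASTA with critical value $\alpha$ outputs any $$\widehat s\in\arg\max_{s\in\mathbb S}\ \inf_{p\in\Omega_n(\alpha)}\mathcal V(s;p),\qquad \Omega_n(\alpha)=\Big\{p\in\mathcal P:\ \widehat L_n(p)-\inf_{q\in\mathcal P}\widehat L_n(q)\le\alpha\Big\}.$$ **Theorem.** There are universal constants $c_1,c_2>0$ such that the following holds in every such setting with $C\ge1$ (the bounds $C_x,C_\Theta,C_\lambda$ may always be enlarged) and $Cn\ge 2D$ (for instance $n\ge 2D$). For every $\delta\in(0,1)$ and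 every $$\alpha\ \ge\ c_1\left\{\frac Dn\left(\log\frac{Cn}{D}+\log(1+\log M)\right)+\frac1n\log\frac1\delta\right\},$$ with probability at least $1-\delta$, every output $\widehat s$ of PASTA with critical value $\alpha$ satisfies $$\mathcal R(\widehat s)\ \le\ c_2\,r_{s^\star}\sqrt{\frac{\alpha}{\pi_S(s^\star)}}.$$ In particular one may take $\alpha=\alpha_n(\delta)$ equal to the right-hand side of the condition on $\alpha$, and for a fixed maximal basket size $M$ this is of the order $\frac Dn\log\frac{Cn}{D}+\frac1n\log\frac1\delta$. -/

import Mathlib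

open scoped BigOperators

noncomputable section

namespace Assortment

/-- A choice model on the items `Fin N`: `p s a` is the probability `p(a | s)` that a customer who is
offered the assortment `s` chooses `a`, where `a = some i` is the purchase of item `i` and `a = none`
is the option of buying nothing. -/
abbrev ChoiceModel (N : ℕ) : Type := Finset (Fin N) → Option (Fin N) → ℝ

/-- An offline data set of size `n`: pairs (offered assortment, customer choice). -/
abbrev Data (N n : ℕ) : Type := Fin n → Finset (Fin N) × Option (Fin N)

/-- Expected revenue `V(s; p) = ∑_{a ∈ s} p(a | s) r(s, a)`. -/
def value {N : ℕ} (r : Finset (Fin N) → Fin N → ℝ) (p : ChoiceModel N) (s : Finset (Fin N)) : ℝ :=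
  ∑ i ∈ s, p s (some i) * r s i

/-- `s` maximizes the expected revenue under `p` among the assortments in `𝕊`. -/
def IsOptimal {N : ℕ} (𝕊 : Finset (Finset (Fin N))) (r : Finset (Fin N) → Fin N → ℝ)
    (p : ChoiceModel N) (s : Finset (Fin N)) : Prop :=
  s ∈ 𝕊 ∧ ∀ t ∈ 𝕊, value r p t ≤ value r p s

/-- The regret `V(s⋆; p₀) - V(s; p₀)` of the assortment `s`. -/
def regret {N : ℕ} (r : Finset (Fin N) → Fin N → ℝ) (p₀ : ChoiceModel N)
    (sStar s : Finset (Fin N)) : ℝ :=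
  value r p₀ sStar - value r p₀ s

/-- The largest revenue `max_{j ∈ s} r(s, j)` of an item of `s` (and `0` for the empty set). -/
def maxRevenue {N : ℕ} (r : Finset (Fin N) → Fin N → ℝ) (s : Finset (Fin N)) : ℝ :=
  if h : s.Nonempty then s.sup' h (r s) else 0

/-- The negative average log-likelihood `-(1/n) ∑ᵢ log p(Aᵢ | Sᵢ)`. -/
def empLoss {N n : ℕ} (D : Data N n) (p : ChoiceModel N) : ℝ :=
  -(1 / (n : ℝ)) * ∑ i, Real.log (p (D i).1 (D i).2)

/-- `p̂` is a maximum likelihood estimator in the family `P`. -/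
def IsMLE {N n : ℕ} (P : Set (ChoiceModel N)) (D : Data N n) (phat : ChoiceModel N) : Prop :=
  phat ∈ P ∧ ∀ q ∈ P, empLoss D phat ≤ empLoss D q

/-- The uncertainty set of all models in `P` whose loss exceeds the smallest loss over `P` by at
most `α`. It is written without naming a minimizer, so that it makes sense also when the likelihood
has no maximizer in `P`; see `uncertaintySet_eq_of_isMLE`. -/
def uncertaintySet {N n : ℕ} (P : Set (ChoiceModel N)) (D : Data N n) (α : ℝ) :
    Set (ChoiceModel N) :=
  {p | p ∈ P ∧ ∀ q ∈ P, empLoss D p - empLoss D q ≤ α}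

theorem uncertaintySet_eq_of_isMLE {N n : ℕ} {P : Set (ChoiceModel N)} {D : Data N n}
    {phat : ChoiceModel N} (h : IsMLE P D phat) (α : ℝ) :
    uncertaintySet P D α = {p | p ∈ P ∧ empLoss D p - empLoss D phat ≤ α} := by
  ext p
  constructor
  · rintro ⟨hp, hq⟩
    exact ⟨hp, hq phat h.1⟩
  · rintro ⟨hp, hq⟩
    exact ⟨hp, fun q hqP => by have := h.2 q hqP; linarith⟩

/-- The worst-case revenue of `s` over a set `Ω` of choice models. -/
def worstValue {N : ℕ} (r : Finset (Fin N) → Fin N → ℝ) (Ω : Set (ChoiceModel N))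
    (s : Finset (Fin N)) : ℝ :=
  sInf ((fun p => value r p s) '' Ω)

/-- `s` is an output of PASTA with critical value `α`: it maximizes, among the assortments in `𝕊`,
the worst-case revenue over the uncertainty set. -/
def IsPasta {N n : ℕ} (𝕊 : Finset (Finset (Fin N))) (r : Finset (Fin N) → Fin N → ℝ)
    (P : Set (ChoiceModel N)) (D : Data N n) (α : ℝ) (s : Finset (Fin N)) : Prop :=
  s ∈ 𝕊 ∧ ∀ t ∈ 𝕊,
    worstValue r (uncertaintySet P D α) t ≤ worstValue r (uncertaintySet P D α) s

/-- `π` is a probability mass function on the assortments in `𝕊`. -/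
def IsPMFOn {N : ℕ} (𝕊 : Finset (Finset (Fin N))) (π : Finset (Fin N) → ℝ) : Prop :=
  (∀ s, 0 ≤ π s) ∧ (∀ s, s ∉ 𝕊 → π s = 0) ∧ ∑ s ∈ 𝕊, π s = 1

/-- The probability of the event `E` for `n` i.i.d. observations `(Sᵢ, Aᵢ)` with probability mass
function `(s, a) ↦ π(s) p₀(a | s)`. -/
def dataProb {N n : ℕ} (π : Finset (Fin N) → ℝ) (p₀ : ChoiceModel N) (E : Set (Data N n)) : ℝ :=
  ∑ D : Data N n, E.indicator (fun D => ∏ i, π (D i).1 * p₀ (D i).1 (D i).2) D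

/-- A nested logit parameter `(θ, lam)`: a preference vector and one dissimilarity parameter for
each of the `K` baskets. -/
abbrev NLParam (d K : ℕ) : Type := EuclideanSpace ℝ (Fin d) × (Fin K → ℝ)

/-- The attraction `v_k = ∑_{i ∈ s, i in basket k} exp(⟨x_i, θ⟩ / λ_k)` of basket `k`. The partition
of the items into baskets is given by the map `B` that sends an item to its basket. -/
def nlAttraction {N d K : ℕ} (x : Fin N → EuclideanSpace ℝ (Fin d)) (B : Fin N → Fin K)
    (ϑ : NLParam d K) (s : Finset (Fin N)) (k : Fin K) : ℝ :=
  ∑ i ∈ s with B i = k, Real.exp (inner ℝ (x i) ϑ.1 / ϑ.2 k)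

/-- The normalizing constant `1 + ∑_k v_k ^ λ_k`. -/
def nlNorm {N d K : ℕ} (x : Fin N → EuclideanSpace ℝ (Fin d)) (B : Fin N → Fin K)
    (ϑ : NLParam d K) (s : Finset (Fin N)) : ℝ :=
  1 + ∑ k, nlAttraction x B ϑ s k ^ ϑ.2 k

/-- The nested logit choice model with item features `x`, baskets `B` and parameter `ϑ`. -/
def nlModel {N d K : ℕ} (x : Fin N → EuclideanSpace ℝ (Fin d)) (B : Fin N → Fin K)
    (ϑ : NLParam d K) : ChoiceModel N
  | s, none => 1 / nlNorm x B ϑ s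
  | s, some i =>
      if i ∈ s then
        nlAttraction x B ϑ s (B i) ^ (ϑ.2 (B i) - 1) / nlNorm x B ϑ s *
          Real.exp (inner ℝ (x i) ϑ.1 / ϑ.2 (B i))
      else 0

/-- The nested logit family with parameter space `Θ`. -/
def nlFamily {N d K : ℕ} (x : Fin N → EuclideanSpace ℝ (Fin d)) (B : Fin N → Fin K)
    (Θ : Set (NLParam d K)) : Set (ChoiceModel N) :=
  nlModel x B '' Θ

/-- The number of items in the largest basket. -/
def maxBasketSize {N K : ℕ} (B : Fin N → Fin K) : ℕ :=
  Finset.univ.sup fun k : Fin K => (Finset.univ.filter fun i : Fin N => B i = k).card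

/-- Features bounded by `Cx`, preference vectors bounded by `CΘ`, dissimilarity parameters in
`(0, 1]` and bounded away from zero by `1 / Cl`. -/
def NLBounded {N d K : ℕ} (x : Fin N → EuclideanSpace ℝ (Fin d)) (Θ : Set (NLParam d K))
    (Cx CΘ Cl : ℝ) : Prop :=
  (∀ j, ‖x j‖ ≤ Cx) ∧
    ∀ ϑ ∈ Θ, ‖ϑ.1‖ ≤ CΘ ∧ ∀ k, 0 < ϑ.2 k ∧ ϑ.2 k ≤ 1 ∧ 1 / ϑ.2 k ≤ Cl

/-- The order of the critical value: with effective dimension `D`, boundedness constant `C`, largest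
basket size `M`, sample size `n` and confidence level `1 - δ`, it is
`(D / n) * (log (C n / D) + log (1 + log M)) + (1 / n) * log (1 / δ)`. -/
def criticalRate (D C M n δ : ℝ) : ℝ :=
  D / n * (Real.log (C * n / D) + Real.log (1 + Real.log M)) + 1 / n * Real.log (1 / δ)

end Assortment

end

/-! PASTA is pessimistic: once `p₀` lies in the uncertainty set Ω, the regret is at most the largest
drop V(s⋆; p₀) - V(s⋆; p) over p in Ω (`regret_le_of_isPasta`). Only the accuracy of the models at
s⋆ matters, which is why coverage enters through π(s⋆) alone.

Both facts needed, that `p₀` is in Ω and that every p in Ω is close to `p₀`, come from one Chernoff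
bound. The square root of the likelihood ratio q/p₀ has mean 1 - H²/2 ≤ exp(-H²/2), where H² is the
squared Hellinger distance averaged over π. A union bound over a finite net 𝒩 then gives, outside an
event of probability δ, L(p₀) - L(q) ≤ -H²(q, p₀) + (2/n) log(|𝒩|/δ) for all q in 𝒩
(`dataProb_ge_of_forall_loss`). A net that is uniform in log p carries this over to the whole
family, with no lower bound on choice probabilities.

The entropy (`exists_nlFamily_net`) rests on writing p(a | s) as basket probability times softmax
within the basket. Basket probabilities involve v_k^λ_k, the ℓ^(1/λ_k) norm of the weights
exp(x_i·θ), whose logarithm is (log M)-Lipschitz in λ_k. The softmax is Lipschitz in 1/λ_k, with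
constant of order Cx CΘ. Gridding λ_k and 1/λ_k separately makes M enter the entropy only as K log(1
+ log M). The mesh D/n keeps the discretization error within the rate. -/

noncomputable section

namespace Assortment

/-! ### Covering numbers of balls -/

open MeasureTheory Metric in
/-- Volumetric bound: a `ρ`-separated subset of the ball of radius `R` has at most
`(1 + 2 R / ρ) ^ dim` elements. -/
theorem card_le_of_separated_of_norm_le {E : Type*} [NormedAddCommGroup E] [NormedSpace ℝ E]
    [FiniteDimensional ℝ E] {R ρ : ℝ} (hR : 0 ≤ R) (hρ : 0 < ρ) (s : Finset E)
    (hs : ∀ c ∈ s, ‖c‖ ≤ R) (h : ∀ c ∈ s, ∀ d ∈ s, c ≠ d → ρ ≤ ‖c - d‖) :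
    (s.card : ℝ) ≤ (1 + 2 * R / ρ) ^ Module.finrank ℝ E := by
  borelize E
  let μ : Measure E := Measure.addHaar
  have hr : 0 < ρ / 2 := by positivity
  have hr' : 0 < R + ρ / 2 := by positivity
  have hdisj : (s : Set E).PairwiseDisjoint fun c => ball c (ρ / 2) := by
    intro c hc d hd hcd
    apply ball_disjoint_ball
    rw [dist_eq_norm]
    linarith [h c hc d hd hcd]
  have hsub : (⋃ c ∈ s, ball c (ρ / 2)) ⊆ ball (0 : E) (R + ρ / 2) := by
    refine Set.iUnion₂_subset fun c hc => ball_subset_ball' ?_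
    rw [dist_zero_right]
    linarith [hs c hc]
  have I : (s.card : ENNReal) * ENNReal.ofReal ((ρ / 2) ^ Module.finrank ℝ E) * μ (ball 0 1) ≤
      ENNReal.ofReal ((R + ρ / 2) ^ Module.finrank ℝ E) * μ (ball 0 1) :=
    calc
      _ = μ (⋃ c ∈ s, ball c (ρ / 2)) := by
        rw [measure_biUnion_finset hdisj fun c _ => measurableSet_ball]
        simp only [μ.addHaar_ball_of_pos _ hr, Finset.sum_const, nsmul_eq_mul, mul_assoc]
      _ ≤ μ (ball (0 : E) (R + ρ / 2)) := measure_mono hsub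
      _ = _ := μ.addHaar_ball_of_pos _ hr'
  have J := (ENNReal.mul_le_mul_iff_left (measure_ball_pos _ _ zero_lt_one).ne'
    measure_ball_lt_top.ne).1 I
  have K := ENNReal.toReal_le_of_le_ofReal (pow_nonneg hr'.le _) J
  rw [ENNReal.toReal_mul, ENNReal.toReal_natCast, ENNReal.toReal_ofReal (by positivity)] at K
  have e : 1 + 2 * R / ρ = (R + ρ / 2) / (ρ / 2) := by field_simp; ring
  rw [e, div_pow, le_div_iff₀ (by positivity)]
  exact K

/-- The ball of radius `R` has a `ρ`-net with at most `(1 + 2 R / ρ) ^ dim` points. -/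
theorem exists_finset_net {E : Type*} [NormedAddCommGroup E] [NormedSpace ℝ E]
    [FiniteDimensional ℝ E] {R ρ : ℝ} (hR : 0 ≤ R) (hρ : 0 < ρ) :
    ∃ T : Finset E, (∀ x : E, ‖x‖ ≤ R → ∃ t ∈ T, ‖x - t‖ ≤ ρ) ∧
      (T.card : ℝ) ≤ (1 + 2 * R / ρ) ^ Module.finrank ℝ E := by
  classical
  let good : Set ℕ := {m | ∃ s : Finset E, s.card = m ∧ (∀ c ∈ s, ‖c‖ ≤ R) ∧
    ∀ c ∈ s, ∀ d ∈ s, c ≠ d → ρ ≤ ‖c - d‖}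
  have hne : good.Nonempty := ⟨0, ∅, by simp⟩
  have hbdd : BddAbove good := by
    refine ⟨⌊(1 + 2 * R / ρ) ^ Module.finrank ℝ E⌋₊, ?_⟩
    rintro _ ⟨s, rfl, hs, h⟩
    exact Nat.le_floor (card_le_of_separated_of_norm_le hR hρ s hs h)
  -- A separated set of maximal cardinality, which exists by the volumetric bound, is a net: an
  -- uncovered point could be added to it.
  obtain ⟨T, hT, hTs, hTd⟩ := Nat.sSup_mem hne hbdd
  refine ⟨T, fun x hx => ?_, card_le_of_separated_of_norm_le hR hρ T hTs hTd⟩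
  by_contra! hcon
  have hxT : x ∉ T := fun hxT => by
    have := hcon x hxT
    simp at this
    linarith
  have hmem : (insert x T).card ∈ good := by
    refine ⟨insert x T, rfl, ?_, ?_⟩
    · intro c hc
      rcases Finset.mem_insert.1 hc with rfl | hc
      exacts [hx, hTs c hc]
    · intro c hc d hd hcd
      rcases Finset.mem_insert.1 hc with hcx | hcT <;> rcases Finset.mem_insert.1 hd with hdx | hdT
      · exact absurd (hcx.trans hdx.symm) hcd
      · rw [hcx]; exact (hcon d hdT).le
      · rw [hdx, norm_sub_rev]; exact (hcon c hcT).le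
      · exact hTd c hcT d hdT hcd
  have := le_csSup hbdd hmem
  rw [Finset.card_insert_of_notMem hxT] at this
  omega

/-! ### Dependence of the basket attraction on the dissimilarity parameter -/

theorem sum_rpow_le_rpow_sum {ι : Type*} (s : Finset ι) {f : ι → ℝ} (hf : ∀ i ∈ s, 0 ≤ f i)
    {q : ℝ} (hq : 1 ≤ q) : ∑ i ∈ s, f i ^ q ≤ (∑ i ∈ s, f i) ^ q := by
  have h0 : 0 ≤ ∑ i ∈ s, f i := Finset.sum_nonneg hf
  have key : ∀ t : ℝ, 0 ≤ t → t ^ q = t * t ^ (q - 1) := by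
    intro t ht
    conv_rhs => enter [1]; rw [← Real.rpow_one t]
    rw [← Real.rpow_add_of_nonneg ht zero_le_one (by linarith)]
    congr 1; ring
  rw [key _ h0, Finset.sum_mul]
  refine Finset.sum_le_sum fun i hi => ?_
  rw [key _ (hf i hi)]
  exact mul_le_mul_of_nonneg_left
    (Real.rpow_le_rpow (hf i hi) (Finset.single_le_sum hf hi) (by linarith)) (hf i hi)

theorem sum_exp_le_exp_mul_sum {ι : Type*} (s : Finset ι) {u u' : ι → ℝ} {ε : ℝ}
    (h : ∀ i ∈ s, u' i ≤ u i + ε) :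
    ∑ i ∈ s, Real.exp (u' i) ≤ Real.exp ε * ∑ i ∈ s, Real.exp (u i) := by
  rw [Finset.mul_sum]
  refine Finset.sum_le_sum fun i hi => ?_
  rw [← Real.exp_add]
  exact Real.exp_le_exp.2 (by linarith [h i hi])

/-- Reduces a change of l to a comparison of ℓ^p norms: (∑ exp (y / l)) ^ l is the ℓ^(1/l) norm of
the vector exp y. -/
theorem sum_exp_div_eq {ι : Type*} (s : Finset ι) (y : ι → ℝ) {l l' : ℝ} (hl' : 0 < l') :
    ∑ i ∈ s, Real.exp (y i / l) = ∑ i ∈ s, Real.exp (y i / l') ^ (l' / l) := by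
  refine Finset.sum_congr rfl fun i _ => ?_
  rw [← Real.exp_mul]
  congr 1
  field_simp

/-- The map `l ↦ (∑ exp (y / l)) ^ l` is nondecreasing. -/
theorem sum_exp_div_rpow_mono {ι : Type*} (s : Finset ι) (y : ι → ℝ) {l l' : ℝ} (hl : 0 < l)
    (hll' : l ≤ l') :
    (∑ i ∈ s, Real.exp (y i / l)) ^ l ≤ (∑ i ∈ s, Real.exp (y i / l')) ^ l' := by
  have hl' : 0 < l' := hl.trans_le hll'
  have h0 : 0 ≤ ∑ i ∈ s, Real.exp (y i / l') := Finset.sum_nonneg fun i _ => (Real.exp_pos _).le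
  have h1 : 0 ≤ ∑ i ∈ s, Real.exp (y i / l) := Finset.sum_nonneg fun i _ => (Real.exp_pos _).le
  have h := sum_rpow_le_rpow_sum s (f := fun i => Real.exp (y i / l'))
    (fun i _ => (Real.exp_pos _).le) ((one_le_div hl).2 hll')
  rw [← sum_exp_div_eq s y hl'] at h
  refine (Real.rpow_le_rpow h1 h hl.le).trans_eq ?_
  rw [← Real.rpow_mul h0, div_mul_cancel₀ _ hl.ne']

/-- Power mean inequality with exponent l' / l ≥ 1; it is the reverse of the monotonicity in l, at
the price of a power of the cardinality. -/
theorem sum_exp_div_rpow_le_card {ι : Type*} (s : Finset ι) (y : ι → ℝ) {l l' : ℝ} (hl : 0 < l)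
    (hll' : l ≤ l') :
    (∑ i ∈ s, Real.exp (y i / l')) ^ l' ≤
      (s.card : ℝ) ^ (l' - l) * (∑ i ∈ s, Real.exp (y i / l)) ^ l := by
  have hl' : 0 < l' := hl.trans_le hll'
  have h0 : 0 ≤ ∑ i ∈ s, Real.exp (y i / l') := Finset.sum_nonneg fun i _ => (Real.exp_pos _).le
  have h1 : 0 ≤ ∑ i ∈ s, Real.exp (y i / l) := Finset.sum_nonneg fun i _ => (Real.exp_pos _).le
  have h := Real.rpow_sum_le_const_mul_sum_rpow_of_nonneg s (f := fun i => Real.exp (y i / l'))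
    ((one_le_div hl).2 hll') (fun i _ => (Real.exp_pos _).le)
  rw [← sum_exp_div_eq s y hl'] at h
  have h2 := Real.rpow_le_rpow (Real.rpow_nonneg h0 _) h hl.le
  rw [← Real.rpow_mul h0, div_mul_cancel₀ _ hl.ne', Real.mul_rpow (by positivity) h1,
    ← Real.rpow_mul (by positivity)] at h2
  convert h2 using 3
  field_simp

theorem rpow_card_le_exp {m M : ℕ} (h : m ≤ M) {t : ℝ} (ht : 0 ≤ t) :
    (m : ℝ) ^ t ≤ Real.exp (t * Real.log M) := by
  have hlog : 0 ≤ t * Real.log M := mul_nonneg ht (Real.log_natCast_nonneg M)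
  rcases Nat.eq_zero_or_pos m with rfl | hm
  · rw [Nat.cast_zero]
    exact (Real.rpow_le_one le_rfl zero_le_one ht).trans (Real.one_le_exp hlog)
  · have hM : (0 : ℝ) < M := by exact_mod_cast hm.trans_le h
    rw [mul_comm, ← Real.rpow_def_of_pos hM]
    exact Real.rpow_le_rpow (by positivity) (by exact_mod_cast h) ht

/-- The utilities are changed first, at fixed l': a shift by ε is divided by l' in the exponent and
restored by the outer power, so it costs exp ε whatever the size of l'. Then l' is changed to l,
which costs log M per unit. -/
theorem sum_exp_div_rpow_le_exp_mul {ι : Type*} (s : Finset ι) {y y' : ι → ℝ} {l l' ε : ℝ} {M : ℕ}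
    (hl : 0 < l) (hl' : 0 < l') (hM : s.card ≤ M) (hy : ∀ i ∈ s, y' i ≤ y i + ε) :
    (∑ i ∈ s, Real.exp (y' i / l')) ^ l' ≤
      Real.exp (ε + |l' - l| * Real.log M) * (∑ i ∈ s, Real.exp (y i / l)) ^ l := by
  have h0 : ∀ (z : ι → ℝ) (b : ℝ), 0 ≤ ∑ i ∈ s, Real.exp (z i / b) := fun z b =>
    Finset.sum_nonneg fun i _ => (Real.exp_pos _).le
  have h1 : (∑ i ∈ s, Real.exp (y' i / l')) ^ l' ≤
      Real.exp ε * (∑ i ∈ s, Real.exp (y i / l')) ^ l' := by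
    have h := sum_exp_le_exp_mul_sum s (u := fun i => y i / l') (u' := fun i => y' i / l')
      (ε := ε / l') fun i hi => by
        rw [← add_div]; exact div_le_div_of_nonneg_right (hy i hi) hl'.le
    refine (Real.rpow_le_rpow (h0 _ _) h hl'.le).trans_eq ?_
    rw [Real.mul_rpow (Real.exp_pos _).le (h0 _ _), ← Real.exp_mul, div_mul_cancel₀ _ hl'.ne']
  have h2 : (∑ i ∈ s, Real.exp (y i / l')) ^ l' ≤
      Real.exp (|l' - l| * Real.log M) * (∑ i ∈ s, Real.exp (y i / l)) ^ l := by
    rcases le_total l l' with h | h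
    · refine (sum_exp_div_rpow_le_card s y hl h).trans ?_
      rw [abs_of_nonneg (sub_nonneg.2 h)]
      exact mul_le_mul_of_nonneg_right (rpow_card_le_exp hM (sub_nonneg.2 h))
        (Real.rpow_nonneg (h0 _ _) _)
    · refine (sum_exp_div_rpow_mono s y hl' h).trans ?_
      exact le_mul_of_one_le_left (Real.rpow_nonneg (h0 _ _) _)
        (Real.one_le_exp (mul_nonneg (abs_nonneg _) (Real.log_natCast_nonneg M)))
  rw [Real.exp_add, mul_assoc]
  exact h1.trans (mul_le_mul_of_nonneg_left h2 (Real.exp_pos _).le)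

/-! ### The nested logit model: normalization and Lipschitz dependence on the parameters -/

section Model

variable {N d K : ℕ} {x : Fin N → EuclideanSpace ℝ (Fin d)} {B : Fin N → Fin K}

theorem nlAttraction_nonneg (ϑ : NLParam d K) (s : Finset (Fin N)) (k : Fin K) :
    0 ≤ nlAttraction x B ϑ s k :=
  Finset.sum_nonneg fun _ _ => (Real.exp_pos _).le

theorem nlAttraction_pos (ϑ : NLParam d K) {s : Finset (Fin N)} {i : Fin N} (hi : i ∈ s) :
    0 < nlAttraction x B ϑ s (B i) :=
  Finset.sum_pos (fun _ _ => Real.exp_pos _) ⟨i, by simp [hi]⟩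

theorem nlNorm_pos (ϑ : NLParam d K) (s : Finset (Fin N)) : 0 < nlNorm x B ϑ s :=
  add_pos_of_pos_of_nonneg one_pos
    (Finset.sum_nonneg fun k _ => Real.rpow_nonneg (nlAttraction_nonneg ϑ s k) _)

theorem nlModel_none (ϑ : NLParam d K) (s : Finset (Fin N)) :
    nlModel x B ϑ s none = 1 / nlNorm x B ϑ s := rfl

theorem nlModel_some (ϑ : NLParam d K) {s : Finset (Fin N)} {i : Fin N} (hi : i ∈ s) :
    nlModel x B ϑ s (some i) = nlAttraction x B ϑ s (B i) ^ (ϑ.2 (B i) - 1) / nlNorm x B ϑ s *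
      Real.exp (inner ℝ (x i) ϑ.1 / ϑ.2 (B i)) := if_pos hi

theorem nlModel_some_of_notMem (ϑ : NLParam d K) {s : Finset (Fin N)} {i : Fin N} (hi : i ∉ s) :
    nlModel x B ϑ s (some i) = 0 := if_neg hi

theorem nlModel_some_pos (ϑ : NLParam d K) {s : Finset (Fin N)} {i : Fin N} (hi : i ∈ s) :
    0 < nlModel x B ϑ s (some i) := by
  rw [nlModel_some ϑ hi]
  have := nlNorm_pos (x := x) (B := B) ϑ s
  have := Real.rpow_pos_of_pos (nlAttraction_pos (x := x) (B := B) ϑ hi) (ϑ.2 (B i) - 1)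
  positivity

theorem nlModel_nonneg (ϑ : NLParam d K) (s : Finset (Fin N)) (a : Option (Fin N)) :
    0 ≤ nlModel x B ϑ s a := by
  cases a with
  | none => exact (one_div_pos.2 (nlNorm_pos ϑ s)).le
  | some i =>
    by_cases hi : i ∈ s
    · exact (nlModel_some_pos ϑ hi).le
    · exact (nlModel_some_of_notMem ϑ hi).ge

theorem nlModel_pos_of_pos {ϑ ϑ' : NLParam d K} {s : Finset (Fin N)} {a : Option (Fin N)}
    (h : 0 < nlModel x B ϑ s a) : 0 < nlModel x B ϑ' s a := by
  cases a with
  | none => exact one_div_pos.2 (nlNorm_pos ϑ' s)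
  | some i =>
    by_cases hi : i ∈ s
    · exact nlModel_some_pos ϑ' hi
    · exact absurd (nlModel_some_of_notMem ϑ hi) h.ne'

/-- The choice probabilities factor into a basket probability and a softmax within the basket. -/
theorem nlModel_some_eq_mul (ϑ : NLParam d K) {s : Finset (Fin N)} {i : Fin N} (hi : i ∈ s) :
    nlModel x B ϑ s (some i) = nlAttraction x B ϑ s (B i) ^ ϑ.2 (B i) / nlNorm x B ϑ s *
      (Real.exp (inner ℝ (x i) ϑ.1 / ϑ.2 (B i)) / nlAttraction x B ϑ s (B i)) := by
  have hv := nlAttraction_pos (x := x) (B := B) ϑ hi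
  rw [nlModel_some ϑ hi, Real.rpow_sub_one hv.ne']
  ring

theorem sum_nlModel {ϑ : NLParam d K} (hϑ : ∀ k, 0 < ϑ.2 k) (s : Finset (Fin N)) :
    ∑ a, nlModel x B ϑ s a = 1 := by
  have hn := nlNorm_pos (x := x) (B := B) ϑ s
  have h1 : ∑ i, nlModel x B ϑ s (some i) = ∑ i ∈ s, nlModel x B ϑ s (some i) :=
    (Finset.sum_subset (Finset.subset_univ s) fun i _ hi => nlModel_some_of_notMem ϑ hi).symm
  have h2 : ∀ k, ∑ i ∈ s with B i = k, nlModel x B ϑ s (some i) =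
      nlAttraction x B ϑ s k ^ ϑ.2 k / nlNorm x B ϑ s := by
    intro k
    have : ∀ i ∈ s.filter (B · = k), nlModel x B ϑ s (some i) =
        nlAttraction x B ϑ s k ^ (ϑ.2 k - 1) / nlNorm x B ϑ s *
          Real.exp (inner ℝ (x i) ϑ.1 / ϑ.2 k) := by
      intro i hi
      obtain ⟨his, rfl⟩ := Finset.mem_filter.1 hi
      exact nlModel_some ϑ his
    rw [Finset.sum_congr rfl this, ← Finset.mul_sum]
    change _ * nlAttraction x B ϑ s k = _
    rcases (nlAttraction_nonneg (x := x) (B := B) ϑ s k).eq_or_lt with h | h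
    -- A basket that does not meet the assortment has attraction 0; positivity of λ_k makes its
    -- power 0 as well.
    · rw [← h, Real.zero_rpow (hϑ k).ne']; simp
    · rw [Real.rpow_sub_one h.ne']; field_simp
  rw [Fintype.sum_option, h1, ← Finset.sum_fiberwise_of_maps_to (g := B) (t := Finset.univ)
    (fun _ _ => Finset.mem_univ _), Finset.sum_congr rfl fun k _ => h2 k, ← Finset.sum_div,
    nlModel_none, ← add_div]
  exact div_self hn.ne'

theorem card_filter_basket_le (s : Finset (Fin N)) (k : Fin K) :
    (s.filter (B · = k)).card ≤ maxBasketSize B :=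
  (Finset.card_le_card (Finset.filter_subset_filter _ (Finset.subset_univ s))).trans
    (Finset.le_sup (f := fun k : Fin K => (Finset.univ.filter fun i : Fin N => B i = k).card)
      (Finset.mem_univ k))

theorem abs_inner_sub_inner_le {V : Type*} [NormedAddCommGroup V] [InnerProductSpace ℝ V] {u v w : V}
    {C : ℝ} (hu : ‖u‖ ≤ C) : |inner ℝ u v - inner ℝ u w| ≤ C * ‖v - w‖ := by
  rw [← inner_sub_right]
  exact (abs_real_inner_le_norm _ _).trans (mul_le_mul_of_nonneg_right hu (norm_nonneg _))

variable {Θ : Set (NLParam d K)} {Cx CΘ Cl η : ℝ} {ϑ ϑ' : NLParam d K}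

theorem nlAttraction_rpow_le (hΘ : NLBounded x Θ Cx CΘ Cl) (hCx : 0 ≤ Cx)
    (h : ϑ ∈ Θ) (h' : ϑ' ∈ Θ) (hθ : Cx * Cl * ‖ϑ'.1 - ϑ.1‖ ≤ η)
    (hl : ∀ k, |ϑ'.2 k - ϑ.2 k| * Real.log (maxBasketSize B) ≤ η) (s : Finset (Fin N))
    (k : Fin K) :
    nlAttraction x B ϑ' s k ^ ϑ'.2 k ≤ Real.exp (2 * η) * nlAttraction x B ϑ s k ^ ϑ.2 k := by
  obtain ⟨-, hb⟩ := hΘ.2 ϑ h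
  obtain ⟨-, hb'⟩ := hΘ.2 ϑ' h'
  have hCl : 1 ≤ Cl := (one_le_one_div (hb k).1 (hb k).2.1).trans (hb k).2.2
  have hθ' : Cx * ‖ϑ'.1 - ϑ.1‖ ≤ η := by
    refine le_trans (mul_le_mul_of_nonneg_right ?_ (norm_nonneg _)) hθ
    exact le_mul_of_one_le_right hCx hCl
  have key := sum_exp_div_rpow_le_exp_mul (s.filter (B · = k)) (y := fun i => inner ℝ (x i) ϑ.1)
    (y' := fun i => inner ℝ (x i) ϑ'.1) (hb k).1 (hb' k).1 (card_filter_basket_le s k) (ε := η)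
    fun i _ => by
      have := (abs_le.1 ((abs_inner_sub_inner_le (v := ϑ'.1) (w := ϑ.1) (hΘ.1 i)).trans hθ')).2
      linarith
  refine key.trans (mul_le_mul_of_nonneg_right (Real.exp_le_exp.2 ?_)
    (Real.rpow_nonneg (nlAttraction_nonneg ϑ s k) _))
  linarith [hl k]

theorem nlNorm_le {s : Finset (Fin N)} (hη : 0 ≤ η)
    (hG : ∀ k, nlAttraction x B ϑ' s k ^ ϑ'.2 k ≤
      Real.exp (2 * η) * nlAttraction x B ϑ s k ^ ϑ.2 k) :
    nlNorm x B ϑ' s ≤ Real.exp (2 * η) * nlNorm x B ϑ s := by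
  rw [nlNorm, nlNorm, mul_add, mul_one, Finset.mul_sum]
  exact add_le_add (Real.one_le_exp (by positivity)) (Finset.sum_le_sum fun k _ => hG k)

/-- One η pays for the change of θ, using 1/λ ≤ Cl, and one for the change of 1/λ, using |⟨x, θ⟩| ≤
Cx CΘ. -/
theorem abs_utility_sub_le (hΘ : NLBounded x Θ Cx CΘ Cl) (hCx : 0 ≤ Cx)
    (h : ϑ ∈ Θ) (h' : ϑ' ∈ Θ) (hθ : Cx * Cl * ‖ϑ'.1 - ϑ.1‖ ≤ η)
    (hτ : ∀ k, Cx * CΘ * |1 / ϑ'.2 k - 1 / ϑ.2 k| ≤ η) (i : Fin N) (k : Fin K) :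
    |inner ℝ (x i) ϑ'.1 / ϑ'.2 k - inner ℝ (x i) ϑ.1 / ϑ.2 k| ≤ 2 * η := by
  obtain ⟨hn, hb⟩ := hΘ.2 ϑ h
  obtain ⟨-, hb'⟩ := hΘ.2 ϑ' h'
  have e : inner ℝ (x i) ϑ'.1 / ϑ'.2 k - inner ℝ (x i) ϑ.1 / ϑ.2 k =
      (inner ℝ (x i) ϑ'.1 - inner ℝ (x i) ϑ.1) * (1 / ϑ'.2 k) +
        inner ℝ (x i) ϑ.1 * (1 / ϑ'.2 k - 1 / ϑ.2 k) := by ring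
  have h1 : |(inner ℝ (x i) ϑ'.1 - inner ℝ (x i) ϑ.1) * (1 / ϑ'.2 k)| ≤ η := by
    rw [abs_mul, abs_of_pos (one_div_pos.2 (hb' k).1)]
    refine le_trans (mul_le_mul (abs_inner_sub_inner_le (hΘ.1 i)) (hb' k).2.2
      (one_div_pos.2 (hb' k).1).le (by positivity)) (le_trans (le_of_eq ?_) hθ)
    ring
  have h2 : |inner ℝ (x i) ϑ.1 * (1 / ϑ'.2 k - 1 / ϑ.2 k)| ≤ η := by
    rw [abs_mul]
    refine le_trans (mul_le_mul_of_nonneg_right ?_ (abs_nonneg _)) (hτ k)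
    exact (abs_real_inner_le_norm _ _).trans (mul_le_mul (hΘ.1 i) hn (norm_nonneg _) hCx)
  rw [e]
  linarith [abs_add_le ((inner ℝ (x i) ϑ'.1 - inner ℝ (x i) ϑ.1) * (1 / ϑ'.2 k))
    (inner ℝ (x i) ϑ.1 * (1 / ϑ'.2 k - 1 / ϑ.2 k))]

/-- The log-likelihood of the nested logit model is Lipschitz in the parameters, uniformly over
assortments and choices. -/
theorem nlModel_le_exp_mul (hΘ : NLBounded x Θ Cx CΘ Cl) (hCx : 0 ≤ Cx) (hη : 0 ≤ η)
    (h : ϑ ∈ Θ) (h' : ϑ' ∈ Θ) (hθ : Cx * Cl * ‖ϑ'.1 - ϑ.1‖ ≤ η)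
    (hτ : ∀ k, Cx * CΘ * |1 / ϑ'.2 k - 1 / ϑ.2 k| ≤ η)
    (hl : ∀ k, |ϑ'.2 k - ϑ.2 k| * Real.log (maxBasketSize B) ≤ η)
    (s : Finset (Fin N)) (a : Option (Fin N)) :
    nlModel x B ϑ' s a ≤ Real.exp (8 * η) * nlModel x B ϑ s a := by
  have hG := nlAttraction_rpow_le hΘ hCx h h' hθ hl s
  have hn := nlNorm_pos (x := x) (B := B) ϑ s
  have hn' := nlNorm_pos (x := x) (B := B) ϑ' s
  have hN : nlNorm x B ϑ s ≤ Real.exp (2 * η) * nlNorm x B ϑ' s := by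
    refine nlNorm_le hη (nlAttraction_rpow_le hΘ hCx h' h ?_ ?_ s)
    · rwa [norm_sub_rev]
    · intro k; rw [abs_sub_comm]; exact hl k
  have hinv : 1 / nlNorm x B ϑ' s ≤ Real.exp (2 * η) * (1 / nlNorm x B ϑ s) := by
    rw [mul_one_div, div_le_div_iff₀ hn' hn, one_mul]
    exact hN
  cases a with
  | none =>
    refine hinv.trans (mul_le_mul_of_nonneg_right (Real.exp_le_exp.2 (by linarith))
      (one_div_pos.2 hn).le)
  | some i =>
    by_cases hi : i ∈ s
    · have hu := fun j => abs_le.1 (abs_utility_sub_le hΘ hCx h h' hθ hτ j (B i))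
      have hv := nlAttraction_pos (x := x) (B := B) ϑ hi
      have hv' := nlAttraction_pos (x := x) (B := B) ϑ' hi
      have h1 : Real.exp (inner ℝ (x i) ϑ'.1 / ϑ'.2 (B i)) ≤
          Real.exp (2 * η) * Real.exp (inner ℝ (x i) ϑ.1 / ϑ.2 (B i)) := by
        rw [← Real.exp_add]
        exact Real.exp_le_exp.2 (by linarith [(hu i).2])
      have h2 : nlAttraction x B ϑ s (B i) ≤ Real.exp (2 * η) * nlAttraction x B ϑ' s (B i) :=
        sum_exp_le_exp_mul_sum _ fun j _ => by linarith [(hu j).1]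
      have h3 : Real.exp (inner ℝ (x i) ϑ'.1 / ϑ'.2 (B i)) / nlAttraction x B ϑ' s (B i) ≤
          Real.exp (4 * η) *
            (Real.exp (inner ℝ (x i) ϑ.1 / ϑ.2 (B i)) / nlAttraction x B ϑ s (B i)) := by
        rw [← mul_div_assoc, div_le_div_iff₀ hv' hv]
        refine (mul_le_mul h1 h2 hv.le (by positivity)).trans_eq ?_
        rw [show 4 * η = 2 * η + 2 * η by ring, Real.exp_add]
        ring
      have hG0 : 0 ≤ nlAttraction x B ϑ s (B i) ^ ϑ.2 (B i) := Real.rpow_nonneg hv.le _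
      have hG0' : 0 ≤ nlAttraction x B ϑ' s (B i) ^ ϑ'.2 (B i) := Real.rpow_nonneg hv'.le _
      rw [nlModel_some_eq_mul ϑ hi, nlModel_some_eq_mul ϑ' hi, div_eq_mul_one_div,
        div_eq_mul_one_div (_ ^ _) (nlNorm x B ϑ s)]
      refine (mul_le_mul (mul_le_mul (hG (B i)) hinv (by positivity) (by positivity)) h3
        (by positivity) (by positivity)).trans_eq ?_
      -- The budget: 2η for the power of the attraction, 2η for the normalizer, 4η for numerator and
      -- denominator of the softmax.
      rw [show 8 * η = 2 * η + 2 * η + 4 * η by ring, Real.exp_add, Real.exp_add]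
      ring
    · rw [nlModel_some_of_notMem ϑ hi, nlModel_some_of_notMem ϑ' hi, mul_zero]

end Model

/-! ### Metric entropy of the family -/

theorem abs_sub_le_one_of_natFloor_eq {a b : ℝ} (ha : 0 ≤ a) (hb : 0 ≤ b) (h : ⌊a⌋₊ = ⌊b⌋₊) :
    |a - b| ≤ 1 := by
  have h1 := Nat.floor_le ha
  have h2 := Nat.floor_le hb
  have h3 := Nat.lt_floor_add_one a
  have h4 := Nat.lt_floor_add_one b
  rw [h] at h1 h3
  rw [abs_le]
  constructor <;> linarith

/-- Two nonnegative numbers in the same cell of width `1 / t` differ by at most `1 / t`. -/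
theorem mul_abs_sub_le_of_natFloor_eq {a b t : ℝ} (ha : 0 ≤ a) (hb : 0 ≤ b) (ht : 0 ≤ t)
    (h : ⌊t * a⌋₊ = ⌊t * b⌋₊) : t * |a - b| ≤ 1 := by
  have := abs_sub_le_one_of_natFloor_eq (mul_nonneg ht ha) (mul_nonneg ht hb) h
  rwa [← mul_sub, abs_mul, abs_of_nonneg ht] at this

/-- A finite set `𝒩` of models in `P` such that every model in `P` agrees with one in `𝒩` up to
factors `exp (± κ)`. -/
def IsLogNet {N : ℕ} (P : Set (ChoiceModel N)) (κ : ℝ) (𝒩 : Finset (ChoiceModel N)) : Prop :=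
  (∀ q ∈ 𝒩, q ∈ P) ∧ ∀ p ∈ P, ∃ q ∈ 𝒩, ∀ s a,
    p s a ≤ Real.exp κ * q s a ∧ q s a ≤ Real.exp κ * p s a

/-- Since `Θ` is arbitrary, grid points may fall outside it. The net instead consists of one
parameter of `Θ` from each occupied cell, so its models stay in the family. -/
theorem exists_isLogNet_of_cells {N : ℕ} {X J : Type*} [Fintype J] (m : X → ChoiceModel N)
    (Θ : Set X) {κ : ℝ} (f : Θ → J)
    (hf : ∀ u v : Θ, f u = f v → ∀ s a, m u s a ≤ Real.exp κ * m v s a) :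
    ∃ 𝒩 : Finset (ChoiceModel N), IsLogNet (m '' Θ) κ 𝒩 ∧ 𝒩.card ≤ Fintype.card J := by
  classical
  rcases Θ.eq_empty_or_nonempty with h | ⟨ϑ₀, h₀⟩
  · exact ⟨∅, ⟨by simp, by simp [h]⟩, by simp⟩
  let c : J → Θ := fun j => if h : ∃ u, f u = j then h.choose else ⟨ϑ₀, h₀⟩
  have hc : ∀ u, f (c (f u)) = f u := by
    intro u
    have h : ∃ v, f v = f u := ⟨u, rfl⟩
    simp only [c, dif_pos h]
    exact h.choose_spec
  refine ⟨Finset.univ.image fun j => m (c j), ⟨?_, ?_⟩, Finset.card_image_le⟩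
  · intro q hq
    obtain ⟨j, -, rfl⟩ := Finset.mem_image.1 hq
    exact ⟨c j, (c j).2, rfl⟩
  · rintro _ ⟨ϑ, hϑ, rfl⟩
    refine ⟨m (c (f ⟨ϑ, hϑ⟩)), Finset.mem_image_of_mem _ (Finset.mem_univ _), fun s a => ⟨?_, ?_⟩⟩
    · exact hf ⟨ϑ, hϑ⟩ _ (hc ⟨ϑ, hϑ⟩).symm s a
    · exact hf _ ⟨ϑ, hϑ⟩ (hc ⟨ϑ, hϑ⟩) s a

/-- Metric entropy of the nested logit family in the uniform distance of log-likelihoods. -/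
theorem exists_nlFamily_net {N d K : ℕ} {x : Fin N → EuclideanSpace ℝ (Fin d)}
    {B : Fin N → Fin K} {Θ : Set (NLParam d K)} {Cx CΘ Cl η : ℝ} (hΘ : NLBounded x Θ Cx CΘ Cl)
    (hCx : 0 < Cx) (hCΘ : 0 < CΘ) (hCl : 0 < Cl) (hC : 1 ≤ Cx * CΘ * Cl) (hη : 0 < η)
    (hR : 2 ≤ Cx * CΘ * Cl / η) :
    ∃ 𝒩 : Finset (ChoiceModel N), IsLogNet (nlFamily x B Θ) (8 * η) 𝒩 ∧
      Real.log 𝒩.card ≤ 4 * ((d : ℝ) + K) * Real.log (Cx * CΘ * Cl / η) +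
        K * Real.log (1 + Real.log (maxBasketSize B)) := by
  set R := Cx * CΘ * Cl / η with hRdef
  set m := 1 + Real.log (maxBasketSize B) with hm
  have hm1 : 1 ≤ m := by linarith [Real.log_natCast_nonneg (maxBasketSize B)]
  obtain ⟨T, hT, hTc⟩ := exists_finset_net (E := EuclideanSpace ℝ (Fin d)) hCΘ.le
    (ρ := η / (2 * Cx * Cl)) (by positivity)
  have hT' : ∀ ϑ : Θ, ∃ t : T, ‖ϑ.1.1 - t‖ ≤ η / (2 * Cx * Cl) := fun ϑ => by
    obtain ⟨t, ht, h⟩ := hT ϑ.1.1 (hΘ.2 _ ϑ.2).1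
    exact ⟨⟨t, ht⟩, h⟩
  choose g hg using hT'
  have hτfloor : ∀ (ϑ : Θ) (k : Fin K), ⌊Cx * CΘ / η * (1 / ϑ.1.2 k)⌋₊ < ⌊R⌋₊ + 1 := by
    intro ϑ k
    refine Nat.lt_succ_of_le (Nat.floor_le_floor ?_)
    calc _ ≤ Cx * CΘ / η * Cl :=
          mul_le_mul_of_nonneg_left ((hΘ.2 _ ϑ.2).2 k).2.2 (by positivity)
      _ = R := by rw [hRdef]; ring
  have hlfloor : ∀ (ϑ : Θ) (k : Fin K), ⌊m / η * ϑ.1.2 k⌋₊ < ⌊m / η⌋₊ + 1 := by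
    intro ϑ k
    refine Nat.lt_succ_of_le (Nat.floor_le_floor ?_)
    exact mul_le_of_le_one_right (by positivity) ((hΘ.2 _ ϑ.2).2 k).2.1
  -- A cell records a nearby net point for θ and, for each basket, the positions of 1/λ_k on a grid
  -- of mesh η/(Cx CΘ) and of λ_k on a grid of mesh η/m.
  let f : Θ → T × (Fin K → Fin (⌊R⌋₊ + 1) × Fin (⌊m / η⌋₊ + 1)) := fun ϑ =>
    (g ϑ, fun k => (⟨_, hτfloor ϑ k⟩, ⟨_, hlfloor ϑ k⟩))
  obtain ⟨𝒩, hN, hcard⟩ := exists_isLogNet_of_cells (nlModel x B) Θ (κ := 8 * η) f (by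
    intro u v huv
    have hk : ∀ k, ⌊Cx * CΘ / η * (1 / u.1.2 k)⌋₊ = ⌊Cx * CΘ / η * (1 / v.1.2 k)⌋₊ ∧
        ⌊m / η * u.1.2 k⌋₊ = ⌊m / η * v.1.2 k⌋₊ := by
      intro k
      have := congrFun (congrArg Prod.snd huv) k
      simpa [f] using this
    have hpos : ∀ (w : Θ) k, 0 < w.1.2 k := fun w k => ((hΘ.2 _ w.2).2 k).1
    refine nlModel_le_exp_mul hΘ hCx.le hη.le v.2 u.2 ?_ ?_ ?_
    · have h1 := hg u
      have h2 := hg v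
      rw [← show g u = g v from congrArg Prod.fst huv] at h2
      have h3 : ‖u.1.1 - v.1.1‖ ≤ η / (2 * Cx * Cl) + η / (2 * Cx * Cl) := by
        refine (norm_sub_le_norm_sub_add_norm_sub _ (g u : EuclideanSpace ℝ (Fin d)) _).trans ?_
        rw [norm_sub_rev _ v.1.1]
        exact add_le_add h1 h2
      calc _ ≤ Cx * Cl * (η / (2 * Cx * Cl) + η / (2 * Cx * Cl)) :=
            mul_le_mul_of_nonneg_left h3 (by positivity)
        _ = η := by field_simp; norm_num
    · intro k
      have := mul_abs_sub_le_of_natFloor_eq (one_div_pos.2 (hpos u k)).le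
        (one_div_pos.2 (hpos v k)).le (by positivity) (hk k).1
      rwa [div_mul_eq_mul_div, div_le_one hη] at this
    · intro k
      have := mul_abs_sub_le_of_natFloor_eq (hpos u k).le (hpos v k).le (by positivity) (hk k).2
      rw [div_mul_eq_mul_div, div_le_one hη] at this
      refine le_trans ?_ this
      rw [mul_comm]
      exact mul_le_mul_of_nonneg_right (by linarith) (abs_nonneg _))
  refine ⟨𝒩, hN, ?_⟩
  have hR0 : 0 < R := by linarith
  have hlogR : 0 ≤ Real.log R := Real.log_nonneg (by linarith)
  have hlogm : 0 ≤ Real.log m := Real.log_nonneg hm1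
  rcases Nat.eq_zero_or_pos 𝒩.card with h0 | h0
  · rw [h0, Nat.cast_zero, Real.log_zero]; positivity
  have hT1 : (T.card : ℝ) ≤ (R ^ 4) ^ d := by
    rw [finrank_euclideanSpace_fin] at hTc
    refine hTc.trans (pow_le_pow_left₀ (by positivity) ?_ d)
    have e : 2 * CΘ / (η / (2 * Cx * Cl)) = 4 * R := by rw [hRdef]; field_simp; norm_num
    rw [e]
    -- For R ≥ 2, 1 + 4R ≤ R⁴. The two floor counts below are at most R² and m R², so every
    -- coordinate of θ and every basket contributes four factors R.
    nlinarith [mul_nonneg (sub_nonneg.2 hR) (sub_nonneg.2 hR), sq_nonneg (R ^ 2 - 4)]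
  have h1 : ((⌊R⌋₊ + 1 : ℕ) : ℝ) ≤ R ^ 2 := by
    push_cast
    nlinarith [Nat.floor_le hR0.le]
  have h2 : ((⌊m / η⌋₊ + 1 : ℕ) : ℝ) ≤ m * R ^ 2 := by
    have ha : m / η ≤ m * R := by
      rw [div_eq_mul_one_div]
      refine mul_le_mul_of_nonneg_left ?_ (by linarith)
      exact div_le_div_of_nonneg_right hC hη.le
    push_cast
    have := Nat.floor_le (show 0 ≤ m / η by positivity)
    nlinarith [mul_le_mul hm1 (show 1 ≤ R ^ 2 - R by nlinarith) zero_le_one (by linarith)]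
  have hJ : (𝒩.card : ℝ) ≤ (R ^ 4) ^ d * (R ^ 2 * (m * R ^ 2)) ^ K := by
    refine le_trans (Nat.cast_le.2 hcard) ?_
    rw [Fintype.card_prod, Fintype.card_pi, Nat.cast_mul]
    simp only [Fintype.card_prod, Fintype.card_fin, Finset.prod_const, Finset.card_univ,
      Fintype.card_coe, Nat.cast_pow]
    refine mul_le_mul hT1 (pow_le_pow_left₀ (by positivity) ?_ K) (by positivity) (by positivity)
    rw [Nat.cast_mul]
    exact mul_le_mul h1 h2 (by positivity) (by positivity)
  refine (Real.log_le_log (Nat.cast_pos.2 h0) hJ).trans_eq ?_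
  have hm0 : 0 < m := by linarith
  rw [Real.log_mul (by positivity) (by positivity), Real.log_pow, Real.log_pow, Real.log_pow,
    Real.log_mul (by positivity) (by positivity), Real.log_mul (by positivity) (by positivity),
    Real.log_pow]
  push_cast
  ring

/-! ### Chernoff bound for an i.i.d. sample -/

theorem sum_prod_apply {Z : Type*} [Fintype Z] [DecidableEq Z] (n : ℕ) (g : Z → ℝ) :
    ∑ D : Fin n → Z, ∏ i, g (D i) = (∑ z, g z) ^ n := by
  rw [← Fintype.piFinset_univ, ← Finset.prod_univ_sum]
  simp

/-- Chernoff's bound for finitely many nonnegative statistics of an i.i.d. sample. -/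
theorem one_sub_le_sum_indicator_forall {Z J : Type*} [Fintype Z] [DecidableEq Z] (𝒩 : Finset J)
    (n : ℕ) {w : Z → ℝ} {g : J → Z → ℝ} {h : J → ℝ} {δ : ℝ} (hw : ∀ z, 0 ≤ w z)
    (hw1 : ∑ z, w z = 1) (hg : ∀ j ∈ 𝒩, ∀ z, 0 ≤ g j z)
    (hgw : ∀ j ∈ 𝒩, ∑ z, w z * g j z ≤ Real.exp (-h j)) (hδ : 0 < δ) :
    1 - δ ≤ ∑ D : Fin n → Z, Set.indicator
      {D : Fin n → Z | ∀ j ∈ 𝒩, ∏ i, g j (D i) ≤ Real.exp (-(n * h j)) * (𝒩.card / δ)}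
      (fun D => ∏ i, w (D i)) D := by
  classical
  have hW : ∀ D : Fin n → Z, 0 ≤ ∏ i, w (D i) := fun D => Finset.prod_nonneg fun i _ => hw _
  have hj : ∀ j ∈ 𝒩, ∑ D : Fin n → Z, (∏ i, w (D i)) *
      ((∏ i, g j (D i)) * (Real.exp (n * h j) * (δ / 𝒩.card))) ≤ δ / 𝒩.card := by
    intro j hj
    have e : ∀ D : Fin n → Z, (∏ i, w (D i)) *
        ((∏ i, g j (D i)) * (Real.exp (n * h j) * (δ / 𝒩.card))) =
        (∏ i, w (D i) * g j (D i)) * (Real.exp (n * h j) * (δ / 𝒩.card)) := by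
      intro D
      rw [Finset.prod_mul_distrib]
      ring
    rw [Finset.sum_congr rfl fun D _ => e D, ← Finset.sum_mul,
      sum_prod_apply n fun z => w z * g j z]
    have h1 : (∑ z, w z * g j z) ^ n ≤ Real.exp (-h j) ^ n :=
      pow_le_pow_left₀ (Finset.sum_nonneg fun z _ => mul_nonneg (hw z) (hg j hj z)) (hgw j hj) n
    refine (mul_le_mul_of_nonneg_right h1 (by positivity)).trans_eq ?_
    rw [← Real.exp_nat_mul, ← mul_assoc, ← Real.exp_add]
    simp
  have hsum : ∑ j ∈ 𝒩, ∑ D : Fin n → Z, (∏ i, w (D i)) *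
      ((∏ i, g j (D i)) * (Real.exp (n * h j) * (δ / 𝒩.card))) ≤ δ := by
    refine (Finset.sum_le_sum hj).trans ?_
    rw [Finset.sum_const, nsmul_eq_mul]
    rcases Nat.eq_zero_or_pos 𝒩.card with h0 | h0
    · simp [h0, hδ.le]
    · field_simp; rfl
  -- Markov's inequality and the union bound, pointwise: if the event fails at j, the j-th rescaled
  -- product is at least 1.
  have hpt : ∀ D : Fin n → Z, ∏ i, w (D i) ≤ Set.indicator
      {D : Fin n → Z | ∀ j ∈ 𝒩, ∏ i, g j (D i) ≤ Real.exp (-(n * h j)) * (𝒩.card / δ)}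
      (fun D => ∏ i, w (D i)) D + ∑ j ∈ 𝒩, (∏ i, w (D i)) *
      ((∏ i, g j (D i)) * (Real.exp (n * h j) * (δ / 𝒩.card))) := by
    intro D
    have hterm : ∀ j ∈ 𝒩, 0 ≤ (∏ i, w (D i)) *
        ((∏ i, g j (D i)) * (Real.exp (n * h j) * (δ / 𝒩.card))) := fun j hj =>
      mul_nonneg (hW D) (mul_nonneg (Finset.prod_nonneg fun i _ => hg j hj _) (by positivity))
    by_cases hD : ∀ j ∈ 𝒩, ∏ i, g j (D i) ≤ Real.exp (-(n * h j)) * (𝒩.card / δ)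
    · rw [Set.indicator_of_mem (by exact hD)]
      exact le_add_of_nonneg_right (Finset.sum_nonneg hterm)
    · rw [Set.indicator_of_notMem (by exact hD), zero_add]
      push Not at hD
      obtain ⟨j, hj, hlt⟩ := hD
      refine le_trans ?_ (Finset.single_le_sum hterm hj)
      have hc : (0 : ℝ) < 𝒩.card := by exact_mod_cast Finset.card_pos.2 ⟨j, hj⟩
      refine le_mul_of_one_le_right (hW D) ?_
      have e : Real.exp (-(n * h j)) * (𝒩.card / δ) * (Real.exp (n * h j) * (δ / 𝒩.card)) = 1 := by
        rw [Real.exp_neg]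
        field_simp
      rw [← e]
      exact mul_le_mul_of_nonneg_right hlt.le (by positivity)
  have h1 : ∑ D : Fin n → Z, ∏ i, w (D i) = 1 := by rw [sum_prod_apply, hw1, one_pow]
  have := Finset.sum_le_sum fun D (_ : D ∈ Finset.univ) => hpt D
  rw [h1, Finset.sum_add_distrib, Finset.sum_comm] at this
  linarith

/-! ### Hellinger distance and likelihood ratios -/

/-- The squared Hellinger distance of two nonnegative functions on a finite type. -/
def hellingerSq {A : Type*} [Fintype A] (p q : A → ℝ) : ℝ := ∑ a, (√(p a) - √(q a)) ^ 2

theorem hellingerSq_nonneg {A : Type*} [Fintype A] (p q : A → ℝ) : 0 ≤ hellingerSq p q :=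
  Finset.sum_nonneg fun _ _ => sq_nonneg _

theorem sum_sqrt_mul_eq {A : Type*} [Fintype A] {p q : A → ℝ} (hp : ∀ a, 0 ≤ p a)
    (hq : ∀ a, 0 ≤ q a) (hp1 : ∑ a, p a = 1) (hq1 : ∑ a, q a = 1) :
    ∑ a, √(p a * q a) = 1 - hellingerSq p q / 2 := by
  have e : ∀ a, (√(p a) - √(q a)) ^ 2 = p a + q a - 2 * √(p a * q a) := by
    intro a
    rw [Real.sqrt_mul (hp a), sub_sq, Real.sq_sqrt (hp a), Real.sq_sqrt (hq a)]
    ring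
  rw [hellingerSq, Finset.sum_congr rfl fun a _ => e a, Finset.sum_sub_distrib,
    Finset.sum_add_distrib, hp1, hq1, ← Finset.mul_sum]
  ring

/-- The total variation distance is dominated by the Hellinger distance. -/
theorem sum_abs_sub_le_hellinger {A : Type*} [Fintype A] {p q : A → ℝ} (hp : ∀ a, 0 ≤ p a)
    (hq : ∀ a, 0 ≤ q a) (hp1 : ∑ a, p a = 1) (hq1 : ∑ a, q a = 1) :
    ∑ a, |p a - q a| ≤ 2 * √(hellingerSq p q) := by
  have e : ∀ a, |p a - q a| = |√(p a) - √(q a)| * (√(p a) + √(q a)) := by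
    intro a
    conv_rhs => enter [2]; rw [← abs_of_nonneg (add_nonneg (Real.sqrt_nonneg (p a))
      (Real.sqrt_nonneg (q a)))]
    rw [← abs_mul, mul_comm, ← sq_sub_sq, Real.sq_sqrt (hp a), Real.sq_sqrt (hq a)]
  have h := Finset.sum_mul_sq_le_sq_mul_sq Finset.univ (fun a => |√(p a) - √(q a)|)
    fun a => √(p a) + √(q a)
  have h4 : ∑ a, (√(p a) + √(q a)) ^ 2 ≤ 2 ^ 2 := by
    have : ∀ a, (√(p a) + √(q a)) ^ 2 ≤ 2 * p a + 2 * q a := by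
      intro a
      nlinarith [sq_nonneg (√(p a) - √(q a)), Real.sq_sqrt (hp a), Real.sq_sqrt (hq a)]
    refine (Finset.sum_le_sum fun a _ => this a).trans_eq ?_
    rw [Finset.sum_add_distrib, ← Finset.mul_sum, ← Finset.mul_sum, hp1, hq1]
    norm_num
  simp only [sq_abs, ← e] at h
  refine (le_abs_self _).trans (Real.abs_le_sqrt (h.trans
    (mul_le_mul_of_nonneg_left h4 (hellingerSq_nonneg p q)))) |>.trans_eq ?_
  change √(hellingerSq p q * 2 ^ 2) = _
  rw [Real.sqrt_mul (hellingerSq_nonneg p q), Real.sqrt_sq (by norm_num), mul_comm]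

section Family

variable {N n : ℕ} {P : Set (ChoiceModel N)} {π : Finset (Fin N) → ℝ} {p₀ : ChoiceModel N}

/-- A family of choice models with a common support. -/
structure IsRegularFamily (P : Set (ChoiceModel N)) : Prop where
  nonneg : ∀ p ∈ P, ∀ s a, 0 ≤ p s a
  sum_eq_one : ∀ p ∈ P, ∀ s, ∑ a, p s a = 1
  pos_of_pos : ∀ p ∈ P, ∀ q ∈ P, ∀ s a, 0 < p s a → 0 < q s a

/-- The mean squared Hellinger distance under the assortment distribution `π`. -/
def meanHellingerSq (π : Finset (Fin N) → ℝ) (p q : ChoiceModel N) : ℝ :=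
  ∑ s, π s * hellingerSq (p s) (q s)

theorem sum_eq_one_of_isPMFOn {𝕊 : Finset (Finset (Fin N))} (hπ : IsPMFOn 𝕊 π) :
    ∑ s, π s = 1 := by
  rw [← hπ.2.2]
  exact (Finset.sum_subset (Finset.subset_univ 𝕊) fun s _ hs => hπ.2.1 s hs).symm

/-- The mean of √(q / p₀) under p₀ is the Hellinger affinity, 1 - H²/2. -/
theorem sum_mul_sqrt_div_le (hP : IsRegularFamily P) (hπ1 : ∑ s, π s = 1)
    (hp₀ : p₀ ∈ P) {q : ChoiceModel N} (hq : q ∈ P) :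
    ∑ z : Finset (Fin N) × Option (Fin N), π z.1 * p₀ z.1 z.2 * √(q z.1 z.2 / p₀ z.1 z.2) ≤
      Real.exp (-(meanHellingerSq π q p₀ / 2)) := by
  have e : ∀ s a, π s * p₀ s a * √(q s a / p₀ s a) = π s * √(q s a * p₀ s a) := by
    intro s a
    rw [mul_assoc]
    congr 1
    rcases (hP.nonneg p₀ hp₀ s a).eq_or_lt with h | h
    -- Where `p₀` vanishes, both sides are 0, so the convention q / 0 = 0 is harmless.
    · simp [← h]
    · rw [Real.sqrt_div (hP.nonneg q hq s a), Real.sqrt_mul (hP.nonneg q hq s a)]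
      have := Real.sqrt_pos.2 h
      field_simp
      rw [Real.sq_sqrt h.le, mul_comm]
  rw [Fintype.sum_prod_type]
  simp only [e, ← Finset.mul_sum]
  rw [Finset.sum_congr rfl fun s _ => by
    rw [sum_sqrt_mul_eq (hP.nonneg q hq s) (hP.nonneg p₀ hp₀ s) (hP.sum_eq_one q hq s)
      (hP.sum_eq_one p₀ hp₀ s)]]
  simp only [mul_sub, mul_one, Finset.sum_sub_distrib, hπ1, ← mul_div_assoc, ← Finset.sum_div]
  exact Real.one_sub_le_exp_neg _

theorem empLoss_sub {D : Data N n} (p q : ChoiceModel N) :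
    empLoss D p - empLoss D q =
      1 / n * ∑ i, (Real.log (q (D i).1 (D i).2) - Real.log (p (D i).1 (D i).2)) := by
  rw [empLoss, empLoss, Finset.sum_sub_distrib]
  ring

theorem empLoss_le_add {D : Data N n} {p q : ChoiceModel N} {κ : ℝ} (hκ : 0 ≤ κ)
    (hp : ∀ i, 0 < p (D i).1 (D i).2) (hq : ∀ i, 0 < q (D i).1 (D i).2)
    (h : ∀ s a, p s a ≤ Real.exp κ * q s a) : empLoss D q ≤ empLoss D p + κ := by
  have h1 : ∑ i, (Real.log (p (D i).1 (D i).2) - Real.log (q (D i).1 (D i).2)) ≤ n * κ := by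
    refine (Finset.sum_le_card_nsmul Finset.univ _ κ fun i _ => ?_).trans_eq (by simp)
    have := Real.log_le_log (hp i) (h _ _)
    rw [Real.log_mul (Real.exp_pos _).ne' (hq i).ne', Real.log_exp] at this
    linarith
  have h2 := empLoss_sub (D := D) q p
  have h3 : empLoss D q - empLoss D p ≤ κ := by
    rw [h2]
    refine (mul_le_mul_of_nonneg_left h1 (by positivity)).trans ?_
    rcases Nat.eq_zero_or_pos n with rfl | hn
    · simpa using hκ
    · field_simp; rfl
  linarith

/-- With high probability the log-likelihood ratios over a net are controlled by the Hellinger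
distances to the true model. -/
theorem dataProb_ge_of_forall_loss {𝕊 : Finset (Finset (Fin N))} (hn : 0 < n)
    (hP : IsRegularFamily P) (hπ : IsPMFOn 𝕊 π) (hp₀ : p₀ ∈ P) {𝒩 : Finset (ChoiceModel N)}
    (h𝒩 : ∀ q ∈ 𝒩, q ∈ P) {δ : ℝ} (hδ : 0 < δ) {E : Set (Data N n)}
    (hE : ∀ D : Data N n, (∀ i, 0 < p₀ (D i).1 (D i).2) →
      (∀ q ∈ 𝒩, empLoss D p₀ - empLoss D q ≤
        -meanHellingerSq π q p₀ + 2 / n * Real.log (𝒩.card / δ)) → D ∈ E) :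
    1 - δ ≤ dataProb π p₀ E := by
  classical
  have hπ1 := sum_eq_one_of_isPMFOn hπ
  have key := one_sub_le_sum_indicator_forall 𝒩 n
    (w := fun z : Finset (Fin N) × Option (Fin N) => π z.1 * p₀ z.1 z.2)
    (g := fun q z => √(q z.1 z.2 / p₀ z.1 z.2)) (h := fun q => meanHellingerSq π q p₀ / 2)
    (fun z => mul_nonneg (hπ.1 _) (hP.nonneg p₀ hp₀ _ _))
    (by
      rw [Fintype.sum_prod_type]
      simp only [← Finset.mul_sum, hP.sum_eq_one p₀ hp₀, mul_one, hπ1])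
    (fun _ _ _ => Real.sqrt_nonneg _)
    (fun q hq => sum_mul_sqrt_div_le hP hπ1 hp₀ (h𝒩 q hq)) hδ
  refine key.trans (Finset.sum_le_sum fun D _ => ?_)
  have hW : 0 ≤ ∏ i, π (D i).1 * p₀ (D i).1 (D i).2 :=
    Finset.prod_nonneg fun i _ => mul_nonneg (hπ.1 _) (hP.nonneg p₀ hp₀ _ _)
  -- Data sets of probability 0 contribute nothing; on the others `p₀`, hence every model in `P`, is
  -- positive at all observations, and logarithms may be taken.
  rcases hW.eq_or_lt with h0 | hpos
  · simp only [Set.indicator_apply, ← h0, ite_self, le_refl]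
  by_cases hD : ∀ q ∈ 𝒩, ∏ i, √(q (D i).1 (D i).2 / p₀ (D i).1 (D i).2) ≤
      Real.exp (-(n * (meanHellingerSq π q p₀ / 2))) * (𝒩.card / δ)
  swap
  · rw [Set.indicator_of_notMem (by exact hD), Set.indicator_apply]
    split_ifs
    exacts [hW, le_rfl]
  rw [Set.indicator_of_mem (by exact hD)]
  have hp : ∀ i, 0 < p₀ (D i).1 (D i).2 := by
    intro i
    refine (hP.nonneg p₀ hp₀ _ _).lt_of_ne fun h => hpos.ne' ?_
    exact Finset.prod_eq_zero (Finset.mem_univ i) (by rw [← h, mul_zero])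
  rw [Set.indicator_of_mem]
  refine hE D hp fun q hq => ?_
  have hqpos : ∀ i, 0 < q (D i).1 (D i).2 := fun i =>
    hP.pos_of_pos p₀ hp₀ q (h𝒩 q hq) _ _ (hp i)
  have hc : (0 : ℝ) < 𝒩.card := by exact_mod_cast Finset.card_pos.2 ⟨q, hq⟩
  have h1 := Real.log_le_log (Finset.prod_pos fun i _ =>
    Real.sqrt_pos.2 (div_pos (hqpos i) (hp i))) (hD q hq)
  rw [Real.log_mul (Real.exp_pos _).ne' (by positivity), Real.log_exp,
    Real.log_prod fun i _ => (Real.sqrt_pos.2 (div_pos (hqpos i) (hp i))).ne'] at h1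
  have h2 : ∀ i, Real.log √(q (D i).1 (D i).2 / p₀ (D i).1 (D i).2) =
      (Real.log (q (D i).1 (D i).2) - Real.log (p₀ (D i).1 (D i).2)) / 2 := fun i => by
    rw [Real.log_sqrt (div_pos (hqpos i) (hp i)).le, Real.log_div (hqpos i).ne' (hp i).ne']
  simp only [h2, ← Finset.sum_div] at h1
  rw [empLoss_sub]
  have hn' : (0 : ℝ) < n := by exact_mod_cast hn
  have h3 := mul_le_mul_of_nonneg_left h1 (show 0 ≤ 2 / (n : ℝ) by positivity)
  have e : 2 / (n : ℝ) * (-(n * (meanHellingerSq π q p₀ / 2)) + Real.log (𝒩.card / δ)) =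
      -meanHellingerSq π q p₀ + 2 / n * Real.log (𝒩.card / δ) := by
    field_simp
  rw [e] at h3
  refine le_trans (le_of_eq ?_) h3
  ring

end Family

/-! ### Comparison of expected revenues -/

theorem one_sub_exp_neg_le_sqrt {κ : ℝ} (hκ : 0 ≤ κ) : 1 - Real.exp (-κ) ≤ √κ := by
  rcases le_total κ 1 with h | h
  · have h1 := Real.one_sub_le_exp_neg κ
    have h2 : κ ≤ √κ := by
      refine Real.le_sqrt_of_sq_le ?_
      nlinarith
    linarith
  · have := Real.exp_pos (-κ)
    have := Real.one_le_sqrt.2 h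
    linarith

section Value

variable {N : ℕ} {P : Set (ChoiceModel N)} {r : Finset (Fin N) → Fin N → ℝ}

theorem le_maxRevenue {s : Finset (Fin N)} {i : Fin N} (hi : i ∈ s) :
    r s i ≤ maxRevenue r s := by
  rw [maxRevenue, dif_pos ⟨i, hi⟩]
  exact Finset.le_sup' (r s) hi

theorem maxRevenue_nonneg {s : Finset (Fin N)} (hr : ∀ i ∈ s, 0 ≤ r s i) :
    0 ≤ maxRevenue r s := by
  rcases s.eq_empty_or_nonempty with rfl | ⟨i, hi⟩
  · simp [maxRevenue]
  · exact (hr i hi).trans (le_maxRevenue hi)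

theorem value_nonneg (hP : IsRegularFamily P) {p : ChoiceModel N} (hp : p ∈ P)
    {s : Finset (Fin N)} (hr : ∀ i ∈ s, 0 ≤ r s i) : 0 ≤ value r p s :=
  Finset.sum_nonneg fun i hi => mul_nonneg (hP.nonneg p hp s _) (hr i hi)

theorem sum_some_le {A : Type*} [Fintype A] (s : Finset A) {f : Option A → ℝ}
    (hf : ∀ a, 0 ≤ f a) : ∑ i ∈ s, f (some i) ≤ ∑ a, f a := by
  rw [Fintype.sum_option]
  exact (Finset.sum_le_univ_sum_of_nonneg fun i => hf _).trans (le_add_of_nonneg_left (hf _))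

theorem value_le_maxRevenue (hP : IsRegularFamily P) {p : ChoiceModel N} (hp : p ∈ P)
    {s : Finset (Fin N)} (hr : ∀ i ∈ s, 0 ≤ r s i) : value r p s ≤ maxRevenue r s := by
  calc value r p s ≤ ∑ i ∈ s, p s (some i) * maxRevenue r s :=
        Finset.sum_le_sum fun i hi => mul_le_mul_of_nonneg_left (le_maxRevenue hi)
          (hP.nonneg p hp s _)
    _ = (∑ i ∈ s, p s (some i)) * maxRevenue r s := (Finset.sum_mul ..).symm
    _ ≤ 1 * maxRevenue r s := mul_le_mul_of_nonneg_right
        ((sum_some_le s (hP.nonneg p hp s)).trans_eq (hP.sum_eq_one p hp s))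
        (maxRevenue_nonneg hr)
    _ = _ := one_mul _

theorem value_sub_le_hellinger (hP : IsRegularFamily P) {p q : ChoiceModel N} (hp : p ∈ P)
    (hq : q ∈ P) {s : Finset (Fin N)} (hr : ∀ i ∈ s, 0 ≤ r s i) :
    value r p s - value r q s ≤ maxRevenue r s * (2 * √(hellingerSq (q s) (p s))) := by
  have h0 := maxRevenue_nonneg hr
  calc value r p s - value r q s = ∑ i ∈ s, (p s (some i) - q s (some i)) * r s i := by
        simp only [value, sub_mul, Finset.sum_sub_distrib]
    _ ≤ ∑ i ∈ s, |q s (some i) - p s (some i)| * maxRevenue r s :=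
        Finset.sum_le_sum fun i hi => by
          rw [abs_sub_comm]
          exact mul_le_mul (le_abs_self _) (le_maxRevenue hi) (hr i hi) (abs_nonneg _)
    _ = (∑ i ∈ s, |q s (some i) - p s (some i)|) * maxRevenue r s := (Finset.sum_mul ..).symm
    _ ≤ (2 * √(hellingerSq (q s) (p s))) * maxRevenue r s := by
        refine mul_le_mul_of_nonneg_right ?_ h0
        exact (sum_some_le s (f := fun a => |q s a - p s a|) fun _ => abs_nonneg _).trans
          (sum_abs_sub_le_hellinger (hP.nonneg q hq s) (hP.nonneg p hp s) (hP.sum_eq_one q hq s)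
            (hP.sum_eq_one p hp s))
    _ = _ := mul_comm _ _

/-- The gap is at most V(q)(1 - exp(-κ)). The crude bound √κ gives this error the same square-root
form as the Hellinger term. -/
theorem value_sub_le_sqrt (hP : IsRegularFamily P) {p q : ChoiceModel N}
    (hq : q ∈ P) {s : Finset (Fin N)} (hr : ∀ i ∈ s, 0 ≤ r s i) {κ : ℝ} (hκ : 0 ≤ κ)
    (h : ∀ a, q s a ≤ Real.exp κ * p s a) :
    value r q s - value r p s ≤ maxRevenue r s * √κ := by
  have h1 : value r q s ≤ Real.exp κ * value r p s := by
    rw [value, value, Finset.mul_sum]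
    refine Finset.sum_le_sum fun i hi => ?_
    rw [← mul_assoc]
    exact mul_le_mul_of_nonneg_right (h _) (hr i hi)
  have h2 : Real.exp (-κ) * value r q s ≤ value r p s := by
    refine (mul_le_mul_of_nonneg_left h1 (Real.exp_pos _).le).trans_eq ?_
    rw [← mul_assoc, ← Real.exp_add]
    simp
  calc value r q s - value r p s ≤ value r q s * (1 - Real.exp (-κ)) := by linarith
    _ ≤ maxRevenue r s * √κ := mul_le_mul (value_le_maxRevenue hP hq hr)
        (one_sub_exp_neg_le_sqrt hκ) (sub_nonneg.2 (Real.exp_le_one_iff.2 (by linarith)))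
        (maxRevenue_nonneg hr)

end Value

/-! ### Pessimism and the regret bound -/

section Regret

variable {N n : ℕ} {P : Set (ChoiceModel N)} {π : Finset (Fin N) → ℝ} {p₀ : ChoiceModel N}
  {𝕊 : Finset (Finset (Fin N))} {r : Finset (Fin N) → Fin N → ℝ} {sStar : Finset (Fin N)}

/-- Pessimism: if the true model is in the uncertainty set, the regret of PASTA is at most the
oscillation of the value of the optimal assortment over the uncertainty set. -/
theorem regret_le_of_isPasta (hP : IsRegularFamily P) (hr : ∀ s ∈ 𝕊, ∀ i ∈ s, 0 ≤ r s i)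
    (hs : sStar ∈ 𝕊) {D : Data N n} {α c : ℝ} (h₀ : p₀ ∈ uncertaintySet P D α)
    (hc : ∀ p ∈ uncertaintySet P D α, value r p₀ sStar - value r p sStar ≤ c)
    {s : Finset (Fin N)} (h : IsPasta 𝕊 r P D α s) : regret r p₀ sStar s ≤ c := by
  have h1 : value r p₀ sStar - c ≤ worstValue r (uncertaintySet P D α) sStar := by
    refine le_csInf ⟨_, p₀, h₀, rfl⟩ ?_
    rintro _ ⟨p, hp, rfl⟩
    linarith [hc p hp]
  have h2 : worstValue r (uncertaintySet P D α) s ≤ value r p₀ s := by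
    refine csInf_le ⟨0, ?_⟩ ⟨p₀, h₀, rfl⟩
    rintro _ ⟨p, hp, rfl⟩
    exact value_nonneg hP hp.1 (hr s h.1)
  have h3 := h.2 sStar hs
  rw [regret]
  linarith

/-- Regret bound for PASTA over a family with a finite net in the distance of log-likelihoods. -/
theorem dataProb_regret_ge_of_isLogNet (hn : 0 < n) (hP : IsRegularFamily P)
    (hr : ∀ s ∈ 𝕊, ∀ i ∈ s, 0 ≤ r s i) (hπ : IsPMFOn 𝕊 π) (hp₀ : p₀ ∈ P) (hs : sStar ∈ 𝕊)
    (hπs : 0 < π sStar) {κ : ℝ} (hκ : 0 ≤ κ) {𝒩 : Finset (ChoiceModel N)}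
    (h𝒩 : IsLogNet P κ 𝒩) {δ α : ℝ} (hδ : 0 < δ) (hδ1 : δ ≤ 1)
    (hα : 2 / n * Real.log (𝒩.card / δ) + κ ≤ α) :
    1 - δ ≤ dataProb π p₀ {D : Data N n | ∀ s, IsPasta 𝕊 r P D α s →
      regret r p₀ sStar s ≤ 4 * maxRevenue r sStar * √(α / π sStar)} := by
  refine dataProb_ge_of_forall_loss hn hP hπ hp₀ h𝒩.1 hδ fun D hD hloss => ?_
  have hpos : ∀ p ∈ P, ∀ i, 0 < p (D i).1 (D i).2 := fun p hp i =>
    hP.pos_of_pos p₀ hp₀ p hp _ _ (hD i)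
  have hH0 : ∀ q, 0 ≤ meanHellingerSq π q p₀ := fun q =>
    Finset.sum_nonneg fun s _ => mul_nonneg (hπ.1 s) (hellingerSq_nonneg _ _)
  have hcard : 0 ≤ 2 / (n : ℝ) * Real.log (𝒩.card / δ) := by
    obtain ⟨q, hq, -⟩ := h𝒩.2 p₀ hp₀
    have : (1 : ℝ) ≤ 𝒩.card := by exact_mod_cast Finset.card_pos.2 ⟨q, hq⟩
    refine mul_nonneg (by positivity) (Real.log_nonneg ?_)
    rw [one_le_div hδ]
    linarith
  have hκα : κ ≤ α := by linarith
  have hα0 : 0 ≤ α := hκ.trans hκα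
  have h₀ : p₀ ∈ uncertaintySet P D α := by
    refine ⟨hp₀, fun p hp => ?_⟩
    obtain ⟨q, hq, hpq⟩ := h𝒩.2 p hp
    have h1 := hloss q hq
    have h2 := empLoss_le_add hκ (hpos p hp) (hpos q (h𝒩.1 q hq)) fun s a => (hpq s a).1
    linarith [hH0 q]
  refine fun s hsp => regret_le_of_isPasta hP hr hs h₀ (fun p hp => ?_) hsp
  obtain ⟨q, hq, hpq⟩ := h𝒩.2 p hp.1
  have hqP := h𝒩.1 q hq
  -- Membership of p costs α, and the passage to q together with the deviation term costs at most
  -- another α.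
  have hH : meanHellingerSq π q p₀ ≤ 2 * α := by
    have h1 := hloss q hq
    have h2 := empLoss_le_add hκ (hpos p hp.1) (hpos q hqP) fun s a => (hpq s a).1
    have h3 := hp.2 p₀ hp₀
    linarith
  have hHs : hellingerSq (q sStar) (p₀ sStar) ≤ 2 * (α / π sStar) := by
    rw [← mul_div_assoc, le_div_iff₀ hπs, mul_comm]
    exact (Finset.single_le_sum (f := fun s => π s * hellingerSq (q s) (p₀ s))
      (fun s _ => mul_nonneg (hπ.1 s) (hellingerSq_nonneg _ _)) (Finset.mem_univ sStar)).trans hH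
  have hπ1 : π sStar ≤ 1 := by
    rw [← hπ.2.2]
    exact Finset.single_le_sum (fun s _ => hπ.1 s) hs
  have hκs : √κ ≤ √(α / π sStar) := Real.sqrt_le_sqrt (by
    rw [le_div_iff₀ hπs]
    nlinarith)
  have hr0 := maxRevenue_nonneg (hr sStar hs)
  -- With √2 ≤ 3/2, passing from `p₀` to q costs 2 · 3/2 = 3 units and from q to p one more, whence
  -- the constant 4.
  have hs2 : √(hellingerSq (q sStar) (p₀ sStar)) ≤ 3 / 2 * √(α / π sStar) := by
    refine (Real.sqrt_le_sqrt hHs).trans ?_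
    rw [Real.sqrt_mul (by norm_num)]
    exact mul_le_mul_of_nonneg_right (Real.sqrt_le_iff.2 ⟨by norm_num, by norm_num⟩)
      (Real.sqrt_nonneg _)
  have h1 := value_sub_le_hellinger hP hp₀ hqP (hr sStar hs)
  have h2 := value_sub_le_sqrt hP (p := p) hqP (hr sStar hs) hκ fun a => (hpq sStar a).2
  have h3 := mul_le_mul_of_nonneg_left hs2 hr0
  have h4 := mul_le_mul_of_nonneg_left hκs hr0
  linarith

theorem isRegularFamily_nlFamily {d K : ℕ} {x : Fin N → EuclideanSpace ℝ (Fin d)}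
    {B : Fin N → Fin K} {Θ : Set (NLParam d K)} {Cx CΘ Cl : ℝ} (hΘ : NLBounded x Θ Cx CΘ Cl) :
    IsRegularFamily (nlFamily x B Θ) where
  nonneg := by
    rintro _ ⟨ϑ, -, rfl⟩ s a
    exact nlModel_nonneg ϑ s a
  sum_eq_one := by
    rintro _ ⟨ϑ, hϑ, rfl⟩ s
    exact sum_nlModel (fun k => ((hΘ.2 ϑ hϑ).2 k).1) s
  pos_of_pos := by
    rintro _ ⟨ϑ, -, rfl⟩ _ ⟨ϑ', -, rfl⟩ s a h
    exact nlModel_pos_of_pos h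

end Regret

end Assortment

end

/-! ### Choice of the mesh and of the constants -/

theorem mainTheorem7 :
    ∃ c₁ c₂ : ℝ, 0 < c₁ ∧ 0 < c₂ ∧
      ∀ (N d K n : ℕ)
        (x : Fin N → EuclideanSpace ℝ (Fin d)) (B : Fin N → Fin K)
        (Θ : Set (Assortment.NLParam d K)) (Cx CΘ Cl : ℝ)
        (𝕊 : Finset (Finset (Fin N))) (r : Finset (Fin N) → Fin N → ℝ)
        (π : Finset (Fin N) → ℝ) (p₀ : Assortment.ChoiceModel N)
        (sStar : Finset (Fin N)) (δ α : ℝ),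
        Assortment.NLBounded x Θ Cx CΘ Cl →
        1 ≤ Cx * CΘ * Cl →
        2 * ((d : ℝ) + K) ≤ Cx * CΘ * Cl * n →
        (∀ s ∈ 𝕊, s.Nonempty) →
        (∀ s ∈ 𝕊, ∀ i ∈ s, 0 ≤ r s i) →
        Assortment.IsPMFOn 𝕊 π →
        p₀ ∈ Assortment.nlFamily x B Θ →
        Assortment.IsOptimal 𝕊 r p₀ sStar →
        0 < π sStar →
        0 < δ → δ < 1 →
        c₁ * Assortment.criticalRate ((d : ℝ) + K) (Cx * CΘ * Cl)
          (Assortment.maxBasketSize B) n δ ≤ α →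
        1 - δ ≤ Assortment.dataProb π p₀
          {D : Assortment.Data N n | ∀ s,
            Assortment.IsPasta 𝕊 r (Assortment.nlFamily x B Θ) D α s →
              Assortment.regret r p₀ sStar s ≤
                c₂ * Assortment.maxRevenue r sStar * Real.sqrt (α / π sStar)} := by
  refine ⟨24, 4, by norm_num, by norm_num, ?_⟩
  intro N d K n x B Θ Cx CΘ Cl 𝕊 r π p₀ sStar δ α hΘ hC hn hne hr hπ hp₀ hs hπs hδ hδ1 hα
  obtain ⟨i, hi⟩ := hne sStar hs.1
  obtain ⟨ϑ, hϑ, -⟩ := id hp₀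
  -- An item of s⋆ lies in some basket, so K ≥ 1 and D > 0.
  have hK : (1 : ℝ) ≤ K := by exact_mod_cast (B i).pos
  have hD : 0 < (d : ℝ) + K := by positivity
  have hCx0 : 0 ≤ Cx := (norm_nonneg _).trans (hΘ.1 i)
  have hCΘ0 : 0 ≤ CΘ := (norm_nonneg _).trans (hΘ.2 ϑ hϑ).1
  have hCl : 0 < Cl := by
    obtain ⟨h1, -, h3⟩ := (hΘ.2 ϑ hϑ).2 (B i)
    exact (one_div_pos.2 h1).trans_le h3
  have hCx : 0 < Cx := hCx0.lt_of_ne (by rintro rfl; norm_num at hC)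
  have hCΘ : 0 < CΘ := hCΘ0.lt_of_ne (by rintro rfl; norm_num at hC)
  have hn0 : 0 < n := by
    rcases Nat.eq_zero_or_pos n with rfl | h
    · rw [Nat.cast_zero, mul_zero] at hn; linarith
    · exact h
  have hn' : (0 : ℝ) < n := by exact_mod_cast hn0
  have hη : 0 < ((d : ℝ) + K) / n := by positivity
  have hRe : Cx * CΘ * Cl / (((d : ℝ) + K) / n) = Cx * CΘ * Cl * n / ((d : ℝ) + K) :=
    div_div_eq_mul_div _ _ _
  have hR : 2 ≤ Cx * CΘ * Cl * n / ((d : ℝ) + K) := by rwa [le_div_iff₀ hD]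
  obtain ⟨𝒩, h𝒩, hcard⟩ :=
    Assortment.exists_nlFamily_net (B := B) hΘ hCx hCΘ hCl hC hη (by rwa [hRe])
  have hP := Assortment.isRegularFamily_nlFamily (B := B) hΘ
  refine Assortment.dataProb_regret_ge_of_isLogNet hn0 hP hr hπ hp₀ hs.1 hπs (by positivity) h𝒩 hδ
    hδ1.le (le_trans ?_ hα)
  rw [hRe] at hcard
  have hN1 : (0 : ℝ) < 𝒩.card := by
    obtain ⟨q, hq, -⟩ := h𝒩.2 _ hp₀
    exact_mod_cast Finset.card_pos.2 ⟨q, hq⟩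
  have hLR : 1 / 2 ≤ Real.log (Cx * CΘ * Cl * n / ((d : ℝ) + K)) :=
    le_trans (by linarith [Real.log_two_gt_d9]) (Real.log_le_log (by norm_num) hR)
  have hLM : 0 ≤ Real.log (1 + Real.log (Assortment.maxBasketSize B)) :=
    Real.log_nonneg (by linarith [Real.log_natCast_nonneg (Assortment.maxBasketSize B)])
  have hLδ : 0 ≤ Real.log (1 / δ) := Real.log_nonneg (by rw [one_le_div hδ]; exact hδ1.le)
  rw [Assortment.criticalRate, div_eq_mul_one_div (𝒩.card : ℝ) δ,
    Real.log_mul hN1.ne' (by positivity)]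
  generalize Real.log (Cx * CΘ * Cl * n / ((d : ℝ) + K)) = LR at *
  generalize Real.log (1 + Real.log (Assortment.maxBasketSize B)) = LM at *
  generalize Real.log (1 / δ) = Lδ at *
  have hd : (0 : ℝ) ≤ d := Nat.cast_nonneg d
  -- Twice the entropy gives 8 D LR + 2 K LM, and 8 D ≤ 16 D LR because LR ≥ 1/2; the total 24 is
  -- the constant c₁.
  have main : 2 * (Real.log 𝒩.card + Lδ) + 8 * ((d : ℝ) + K) ≤
      24 * (((d : ℝ) + K) * (LR + LM) + Lδ) := by
    nlinarith [mul_nonneg hD.le (sub_nonneg.2 hLR), mul_nonneg hd hLM,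
      mul_nonneg (zero_le_one.trans hK) hLM]
  calc _ = (2 * (Real.log 𝒩.card + Lδ) + 8 * ((d : ℝ) + K)) / n := by ring
    _ ≤ 24 * (((d : ℝ) + K) * (LR + LM) + Lδ) / n := div_le_div_of_nonneg_right main hn'.le
    _ = _ := by ring
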